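/- Work on the hypercube $\{0,1\}^n$ with Hamming distance $d$ and the uniform distribution $U_n$. $\mathsf{CONJUNCTIONS}$ is the class of all conjunctions of sets of literals over $x_1,\dots,x_n$. For a budget $\rho(n)\ge 0$, the (exact-in-the-ball) robust risk of a hypothesis $h$ against a target $c$ is $\mathsf R_\rho(h,c)=\Pr_{x\sim U_n}[\exists z:\ d(x,z)\le\rho(n),\ c(z)\ne h(z)]$. A learner with $\mathsf{EX}$ and $\lambda$-$\mathsf{LMQ}$ access is a (possibly randomized and adaptive) procedure that draws uniform random examples labelled by the target $c$, queries the value of $c$ at points at distance at most $\lambda(n)$ from examples it has drawn, and outputs a hypothesis $h:\{0,1\}^n\to\{0,1\}$. It is a sample-efficient $\rho$-robust learner if for all $n$, all $\epsilon,\delta>0$ and all $c\in\mathsf{CONJUNCTIONS}$ it outputs $h$ with $\mathsf R_\rho(h,c)\le\epsilon$ with probability at least $1-\delta$, using numbers of examples and of queries that are bounded by a polynomial in $n,1/\epsilon,1/\delta$. A budget function $\rho:\mathbb N\to\mathbb R_{\ge0}$ is a robustness threshold if a sample-efficient $\rho$-robust learner exists, while for no $\rho'=\omega(\rho)$ does a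 sample-efficient $\rho'$-robust learner exist. The robustness threshold of $\mathsf{CONJUNCTIONS}$ under the uniform distribution with access to $\mathsf{EX}$ and $\mathsf{LMQ}$ is $\Theta(\log n)$. That is: 1. For every query radius $\lambda:\mathbb N\to\mathbb R$, every $\rho:\mathbb N\to\mathbb R_{\ge0}$ with $\rho(n)=\Theta(\log n)$ is a robustness threshold. Moreover, for such $\rho$ there is a $\rho$-robust learner that is a single program of a random access machine, runs in time polynomial in $n,1/\epsilon,1/\delta$, and outputs an explicitly given conjunction (so that its hypotheses are polynomially evaluable). 2. Budgets $\omega(\log n)$ force superpolynomial sample/query complexity, for any query radius: there are absolute constants $\epsilon,\delta>0$ such that for every $\rho:\mathbb N\to\mathbb R_{\ge0}$ with $\rho(n)=\omega(\log n)$, every $k\in\mathbb N$ and all sufficiently large $n$, no learner on $\{0,1\}^n$, even with membership queries at arbitrary points, that for every target in $\mathsf{CONJUNCTIONS}$ outputs $h$ with $\mathsf R_\rho(h,c)\le\epsilon$ with probability at least $1-\delta$ uses at most $n^k$ examples and at most $n^k$ queries on every target. -/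

import Mathlib

open Filter Asymptotics

noncomputable section

namespace RobustLearning

/-- The boolean hypercube `{0,1}^n`; its metric is the Hamming distance. -/
abbrev Cube (n : ℕ) : Type := Fin n → Bool

/-- Concepts and hypotheses on `{0,1}^n`. -/
abbrev BoolFun (n : ℕ) : Type := Cube n → Bool

/-- The conjunction of a set of literals; `(i, true)` is the literal `x_i` and `(i, false)` is the
literal `¬ x_i`. -/
def conj {n : ℕ} (L : Set (Fin n × Bool)) : BoolFun n := by
  classical
  exact fun x => decide (∀ l ∈ L, x l.1 = l.2)

/-- The class CONJUNCTIONS on `{0,1}^n`. -/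
def Conjunctions (n : ℕ) : Set (BoolFun n) := {c | ∃ L : Set (Fin n × Bool), c = conj L}

/-- The uniform distribution on `{0,1}^n`. -/
def uniform (n : ℕ) : PMF (Cube n) := PMF.uniformOfFintype (Cube n)

/-- The exact-in-the-ball robust risk `P_{x ∼ D}[∃ z ∈ B_r(x), c(z) ≠ h(z)]`. -/
def robustRisk {n : ℕ} (D : PMF (Cube n)) (r : ℝ) (h c : BoolFun n) : ENNReal :=
  D.toOuterMeasure {x | ∃ z, (hammingDist x z : ℝ) ≤ r ∧ c z ≠ h z}

/-- A (possibly randomized, adaptive) procedure that interacts with the example oracle `EX` and a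
membership query oracle and then returns an element of `α`. It may stop, draw a labelled example,
query the label of a point, or use internal randomness. -/
inductive Interaction (n : ℕ) (α : Type) : Type
  | ret (a : α) : Interaction n α
  | draw (k : Cube n → Bool → Interaction n α) : Interaction n α
  | query (x : Cube n) (k : Bool → Interaction n α) : Interaction n α
  | random (μ : PMF ℕ) (k : ℕ → Interaction n α) : Interaction n α

namespace Interaction

variable {n : ℕ} {α β : Type}

/-- Sequential composition. -/
def bind : Interaction n α → (α → Interaction n β) → Interaction n β
  | ret a, f => f a
  | draw k, f => draw fun x y => (k x y).bind f
  | query x k, f => query x fun y => (k y).bind f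
  | random μ k, f => random μ fun i => (k i).bind f

/-- The law of the returned value when the target is `c` and examples are drawn independently
from `D`. -/
def law (D : PMF (Cube n)) (c : BoolFun n) : Interaction n α → PMF α
  | ret a => PMF.pure a
  | draw k => D.bind fun x => (k x (c x)).law D c
  | query x k => (k (c x)).law D c
  | random μ k => μ.bind fun i => (k i).law D c

/-- Against the target `c`, at most `m` examples are drawn on every run. -/
def ExamplesAtMost (c : BoolFun n) : Interaction n α → ℕ → Prop
  | ret _, _ => True
  | draw k, m => ∃ m', m = m' + 1 ∧ ∀ x, (k x (c x)).ExamplesAtMost c m'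
  | query x k, m => (k (c x)).ExamplesAtMost c m
  | random μ k, m => ∀ i ∈ μ.support, (k i).ExamplesAtMost c m

/-- Against the target `c`, at most `q` membership queries are made on every run. -/
def QueriesAtMost (c : BoolFun n) : Interaction n α → ℕ → Prop
  | ret _, _ => True
  | draw k, q => ∀ x, (k x (c x)).QueriesAtMost c q
  | query x k, q => ∃ q', q = q' + 1 ∧ (k (c x)).QueriesAtMost c q'
  | random μ k, q => ∀ i ∈ μ.support, (k i).QueriesAtMost c q

/-- Against the target `c`, every membership query is within Hamming distance `r` of an example
that has been drawn (`S` is the set of points drawn so far). -/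
def IsLocal (c : BoolFun n) (r : ℝ) : Interaction n α → Set (Cube n) → Prop
  | ret _, _ => True
  | draw k, S => ∀ x, (k x (c x)).IsLocal c r (insert x S)
  | query x k, S => (∃ y ∈ S, (hammingDist y x : ℝ) ≤ r) ∧ (k (c x)).IsLocal c r S
  | random μ k, S => ∀ i ∈ μ.support, (k i).IsLocal c r S

/-- Against the target `c`, every returned value satisfies `P`. -/
def Always (c : BoolFun n) (P : α → Prop) : Interaction n α → Prop
  | ret a => P a
  | draw k => ∀ x, (k x (c x)).Always c P
  | query x k => (k (c x)).Always c P
  | random μ k => ∀ i ∈ μ.support, (k i).Always c P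

end Interaction

/-- A learner on `{0,1}^n` with `EX` and membership query access, seen information-theoretically:
no computational restriction. It returns an arbitrary hypothesis. -/
abbrev Learner (n : ℕ) : Type := Interaction n (BoolFun n)

/-- Against the target `c`, the learner `A` outputs with probability at least `1 - δ` a hypothesis
of robust risk at most `ε` for the budget `r`. -/
def Succeeds {n : ℕ} (D : PMF (Cube n)) (r ε δ : ℝ) (c : BoolFun n) (A : Learner n) : Prop :=
  ENNReal.ofReal (1 - δ) ≤
    (A.law D c).toOuterMeasure {h | robustRisk D r h c ≤ ENNReal.ofReal ε}

/-- The value of the polynomial `p` at `(n, ⌈1/ε⌉, ⌈1/δ⌉)`. Being bounded by such a value is the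
same as being bounded by a polynomial in `n`, `1/ε`, `1/δ`. -/
def polyBound (p : MvPolynomial (Fin 3) ℕ) (n : ℕ) (ε δ : ℝ) : ℕ :=
  MvPolynomial.eval ![n, ⌈1 / ε⌉₊, ⌈1 / δ⌉₊] p

/-- The class `C` is `ρ`-robustly learnable under the distributions `D` with `EX` and `lam`-local
membership queries, with polynomial sample and query complexity. -/
def SampleEfficientlyLearnable (D : ∀ n, PMF (Cube n)) (C : ∀ n, Set (BoolFun n))
    (lam ρ : ℕ → ℝ) : Prop :=
  ∃ (A : ∀ n : ℕ, ℝ → ℝ → Learner n) (p : MvPolynomial (Fin 3) ℕ),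
    ∀ (n : ℕ) (ε δ : ℝ), 0 < ε → 0 < δ → ∀ c ∈ C n,
      (A n ε δ).ExamplesAtMost c (polyBound p n ε δ) ∧
      (A n ε δ).QueriesAtMost c (polyBound p n ε δ) ∧
      (A n ε δ).IsLocal c (lam n) ∅ ∧
      Succeeds (D n) (ρ n) ε δ c (A n ε δ)

/-- `ρ` is a robustness threshold: budget `ρ` admits a sample-efficient robust learner, and no
budget `ω(ρ)` does. -/
def IsRobustnessThreshold (D : ∀ n, PMF (Cube n)) (C : ∀ n, Set (BoolFun n))
    (lam ρ : ℕ → ℝ) : Prop :=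
  SampleEfficientlyLearnable D C lam ρ ∧
    ∀ ρ' : ℕ → ℝ, (∀ n, 0 ≤ ρ' n) → ρ =o[atTop] ρ' → ¬ SampleEfficientlyLearnable D C lam ρ'

/-! ### A random access machine with oracles and a step count -/

/-- Programs of a random access machine with registers and a heap, both holding natural numbers.
The only control structures are `seq`, `ifz` and `loop`, so every program halts. The arithmetic
operations are constants, addition and truncated subtraction, so that after `t` steps all numbers
have `O(t)` bits more than the input and the program text, and the unit-cost step count below is
polynomially related to Turing machine time. -/
inductive Prog : Type
  | const (r k : ℕ) : Prog
  | copy (r a : ℕ) : Prog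
  | add (r a b : ℕ) : Prog
  | sub (r a b : ℕ) : Prog
  | load (r a : ℕ) : Prog
  | store (a b : ℕ) : Prog
  | coin (r : ℕ) : Prog
  | ex (a r : ℕ) : Prog
  | mq (a r : ℕ) : Prog
  | seq (P Q : Prog) : Prog
  | ifz (r : ℕ) (P Q : Prog) : Prog
  | loop (r : ℕ) (P : Prog) : Prog

/-- A machine state; `time` is the number of steps made so far. -/
structure State where
  reg : ℕ → ℕ
  heap : ℕ → ℕ
  time : ℕ

namespace State

/-- Advance the clock by `t` steps. -/
def tick (s : State) (t : ℕ) : State := { s with time := s.time + t }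

/-- Write `v` to register `r`. -/
def setReg (s : State) (r v : ℕ) : State := { s with reg := Function.update s.reg r v }

/-- Write `v` to heap cell `a`. -/
def setHeap (s : State) (a v : ℕ) : State := { s with heap := Function.update s.heap a v }

/-- Write the bits of the point `x` to the heap cells `a, …, a + n - 1`. -/
def writePoint {n : ℕ} (s : State) (a : ℕ) (x : Cube n) : State :=
  { s with heap := fun j =>
      if h : a ≤ j ∧ j < a + n then (x ⟨j - a, by omega⟩).toNat else s.heap j }

/-- The point whose bits are in the heap cells `a, …, a + n - 1` (nonzero means `1`). -/
def readPoint (s : State) (n a : ℕ) : Cube n := fun i => decide (s.heap (a + i) ≠ 0)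

/-- The initial state: registers `0, 1, 2` hold the inputs, everything else is `0`. -/
def init (n a b : ℕ) : State where
  reg := fun r => if r = 0 then n else if r = 1 then a else if r = 2 then b else 0
  heap := fun _ => 0
  time := 0

/-- The hypothesis that a state represents: the conjunction of the literals `(i, b)` for which heap
cell `2 i + b` is nonzero. In this representation a hypothesis is evaluated in time `O(n)`. -/
def hypothesis (s : State) (n : ℕ) : BoolFun n :=
  conj {l : Fin n × Bool | s.heap (2 * (l.1 : ℕ) + l.2.toNat) ≠ 0}

end State

/-- The execution of a program in dimension `n`. Every instruction costs one step, except that an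
oracle call costs `n + 1` steps; each round of a loop costs one step more than its body. -/
def Prog.exec (n : ℕ) : Prog → State → Interaction n State
  | const r k, s => .ret ((s.setReg r k).tick 1)
  | copy r a, s => .ret ((s.setReg r (s.reg a)).tick 1)
  | add r a b, s => .ret ((s.setReg r (s.reg a + s.reg b)).tick 1)
  | sub r a b, s => .ret ((s.setReg r (s.reg a - s.reg b)).tick 1)
  | load r a, s => .ret ((s.setReg r (s.heap (s.reg a))).tick 1)
  | store a b, s => .ret ((s.setHeap (s.reg a) (s.reg b)).tick 1)
  | coin r, s => .random ((PMF.uniformOfFintype (Fin 2)).map Fin.val) fun i =>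
      .ret ((s.setReg r i).tick 1)
  | ex a r, s => .draw fun x y =>
      .ret (((s.writePoint (s.reg a) x).setReg r y.toNat).tick (n + 1))
  | mq a r, s => .query (s.readPoint n (s.reg a)) fun y =>
      .ret ((s.setReg r y.toNat).tick (n + 1))
  | seq P Q, s => (P.exec n s).bind (Q.exec n)
  | ifz r P Q, s => if s.reg r = 0 then P.exec n (s.tick 1) else Q.exec n (s.tick 1)
  | loop r P, s => Nat.rec (.ret (s.tick 1))
      (fun _ t => t.bind fun s' => P.exec n (s'.tick 1)) (s.reg r)

/-- The run of a program on the input `(n, ⌈1/ε⌉, ⌈1/δ⌉)`. -/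
def Prog.run (P : Prog) (n : ℕ) (ε δ : ℝ) : Interaction n State :=
  P.exec n (State.init n ⌈1 / ε⌉₊ ⌈1 / δ⌉₊)

/-- The class `C` is `ρ`-robustly learnable under the distributions `D` with `EX` and `lam`-local
membership queries by one program whose running time (hence also the number of oracle calls) is
polynomial in `n`, `1/ε`, `1/δ` and whose hypotheses are explicitly given conjunctions. -/
def PolyTimeLearnable (D : ∀ n, PMF (Cube n)) (C : ∀ n, Set (BoolFun n))
    (lam ρ : ℕ → ℝ) : Prop :=
  ∃ (P : Prog) (p : MvPolynomial (Fin 3) ℕ),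
    ∀ (n : ℕ) (ε δ : ℝ), 0 < ε → 0 < δ → ∀ c ∈ C n,
      (P.run n ε δ).Always c (fun s => s.time ≤ polyBound p n ε δ) ∧
      (P.run n ε δ).IsLocal c (lam n) ∅ ∧
      Succeeds (D n) (ρ n) ε δ c ((P.run n ε δ).bind fun s => .ret (s.hypothesis n))

end RobustLearning

end

open Filter Asymptotics RobustLearning

open Filter Asymptotics RobustLearning

/-! Upper bound. The learner is elimination: draw examples and keep the literals that no positive
example violates. Literals of the target are never deleted, so the hypothesis implies the target
`c`, and an error at `z` forces `c z = true`. If a satisfiable target has `k` literals and `z` is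
within `r` of `x`, then `x` violates at most `r` of them; an exponential moment bounds the
probability of this by `2^r (3/4)^k` (`uniform_card_ne_le`, `robustRisk_le_of_subset`). When that is
at most `ε`, every run succeeds. Otherwise `(4/3)^k < 2^r/ε`, hence `2^k ≤ (2^r/ε)^3`, which is
polynomial for `r = O(log n)`. A literal outside the target is violated by a positive example with
probability at least `2^(-k-1)`, so polynomially many examples recover the target exactly
(`samples_consistentLits_ne_le`). No queries are made, so the query radius is irrelevant.

Lower bound. The `2^l` conjunctions that prescribe the first `l` bits accept disjoint sets, so each
oracle answer can separate at most one of them from the constant `false` (`sum_law_le`). If `l ≤ r`,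
every point is within `r` of each accepting set, so no hypothesis is robust both for `false` and for
one of these targets (`one_le_robustRisk_add`). Hence `2^l ≤ 2 (m + q)` for `m` examples and `q`
queries, and `l` of order `ω(log n)` defeats every polynomial. -/

namespace RobustLearning

/-! ### Procedures that use only the example oracle. -/

namespace Interaction

variable {n : ℕ} {α β : Type}

/-- Against the target `c`, every run draws exactly `m` examples, uses no other resource, and the
list of drawn points and the returned value are related by `Q`. -/
def Traces (c : BoolFun n) : Interaction n α → ℕ → (List (Cube n) → α → Prop) → Prop
  | ret a, m, Q => m = 0 ∧ Q [] a
  | draw k, m, Q => ∃ m', m = m' + 1 ∧ ∀ x, (k x (c x)).Traces c m' fun l a => Q (x :: l) a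
  | query _ _, _, _ => False
  | random _ _, _, _ => False

theorem Traces.mono {c : BoolFun n} {t : Interaction n α} {m : ℕ}
    {Q Q' : List (Cube n) → α → Prop} (h : t.Traces c m Q)
    (hQ : ∀ l a, l.length = m → Q l a → Q' l a) : t.Traces c m Q' := by
  induction t generalizing m Q Q' with
  | ret a => exact ⟨h.1, hQ _ _ h.1.symm h.2⟩
  | draw k ih =>
    obtain ⟨m', rfl, h⟩ := h
    exact ⟨m', rfl, fun x => ih _ _ (h x) fun l a hl => hQ _ _ (by simp [hl])⟩
  | query x k ih => exact h.elim
  | random μ k ih => exact h.elim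

theorem Traces.bind {c : BoolFun n} {t : Interaction n α} {f : α → Interaction n β} {m m' : ℕ}
    {Q : List (Cube n) → α → Prop} {Q' : List (Cube n) → β → Prop} (h : t.Traces c m Q)
    (hf : ∀ l a, Q l a → (f a).Traces c m' fun l' b => Q' (l ++ l') b) :
    (t.bind f).Traces c (m + m') Q' := by
  induction t generalizing m Q Q' with
  | ret a =>
    obtain ⟨rfl, h⟩ := h
    simpa [Interaction.bind] using hf _ _ h
  | draw k ih =>
    obtain ⟨m₁, rfl, h⟩ := h
    exact ⟨m₁ + m', by ring, fun x => ih _ _ (h x) fun l a hl => hf _ _ hl⟩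
  | query x k ih => exact h.elim
  | random μ k ih => exact h.elim

theorem Traces.always {c : BoolFun n} {t : Interaction n α} {m : ℕ}
    {Q : List (Cube n) → α → Prop} {P : α → Prop} (h : t.Traces c m Q)
    (hP : ∀ l a, Q l a → P a) : t.Always c P := by
  induction t generalizing m Q with
  | ret a => exact hP _ _ h.2
  | draw k ih =>
    obtain ⟨m', rfl, h⟩ := h
    exact fun x => ih _ _ (h x) fun l a hl => hP _ _ hl
  | query x k ih => exact h.elim
  | random μ k ih => exact h.elim

theorem Traces.isLocal {c : BoolFun n} {t : Interaction n α} {m : ℕ}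
    {Q : List (Cube n) → α → Prop} (h : t.Traces c m Q) (r : ℝ) (S : Set (Cube n)) :
    t.IsLocal c r S := by
  induction t generalizing m Q S with
  | ret a => trivial
  | draw k ih =>
    obtain ⟨m', rfl, h⟩ := h
    exact fun x => ih _ _ (h x) _
  | query x k ih => exact h.elim
  | random μ k ih => exact h.elim

theorem Traces.queriesAtMost {c : BoolFun n} {t : Interaction n α} {m : ℕ}
    {Q : List (Cube n) → α → Prop} (h : t.Traces c m Q) (q : ℕ) : t.QueriesAtMost c q := by
  induction t generalizing m Q with
  | ret a => trivial
  | draw k ih =>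
    obtain ⟨m', rfl, h⟩ := h
    exact fun x => ih _ _ (h x)
  | query x k ih => exact h.elim
  | random μ k ih => exact h.elim

theorem Traces.examplesAtMost {c : BoolFun n} {t : Interaction n α} {m : ℕ}
    {Q : List (Cube n) → α → Prop} (h : t.Traces c m Q) : t.ExamplesAtMost c m := by
  induction t generalizing m Q with
  | ret a => trivial
  | draw k ih =>
    obtain ⟨m', rfl, h⟩ := h
    exact ⟨m', rfl, fun x => ih _ _ (h x)⟩
  | query x k ih => exact h.elim
  | random μ k ih => exact h.elim

theorem ExamplesAtMost.mono {c : BoolFun n} {t : Interaction n α} {m m' : ℕ}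
    (h : t.ExamplesAtMost c m) (hm : m ≤ m') : t.ExamplesAtMost c m' := by
  induction t generalizing m m' with
  | ret a => trivial
  | draw k ih =>
    obtain ⟨m₁, rfl, h⟩ := h
    exact ⟨m' - 1, by omega, fun x => ih _ _ (h x) (by omega)⟩
  | query x k ih => exact ih _ h hm
  | random μ k ih => exact fun i hi => ih _ (h i hi) hm

theorem QueriesAtMost.mono {c : BoolFun n} {t : Interaction n α} {q q' : ℕ}
    (h : t.QueriesAtMost c q) (hq : q ≤ q') : t.QueriesAtMost c q' := by
  induction t generalizing q q' with
  | ret a => trivial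
  | draw k ih => exact fun x => ih _ _ (h x) hq
  | query x k ih =>
    obtain ⟨q₁, rfl, h⟩ := h
    exact ⟨q' - 1, by omega, ih _ h (by omega)⟩
  | random μ k ih => exact fun i hi => ih _ (h i hi) hq

end Interaction

/-! ### Independent samples and output laws. -/

/-- The law of a list of `m` independent samples from `D`. -/
noncomputable def samples {n : ℕ} (D : PMF (Cube n)) : ℕ → PMF (List (Cube n))
  | 0 => PMF.pure []
  | m + 1 => D.bind fun x => (samples D m).map (x :: ·)

theorem samples_succ_apply {n : ℕ} (D : PMF (Cube n)) (m : ℕ) (G : Set (List (Cube n))) :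
    (samples D (m + 1)).toOuterMeasure G =
      ∑' x, D x * (samples D m).toOuterMeasure {l | x :: l ∈ G} := by
  simp [samples, PMF.toOuterMeasure_bind_apply, PMF.toOuterMeasure_map_apply, Set.preimage]

/-- This reduces success of the program to a statement about a list of independent points: the only
randomness in such a run is that of its draws. -/
theorem Interaction.Traces.le_law {n : ℕ} {α : Type} {c : BoolFun n} {t : Interaction n α} {m : ℕ}
    {Q : List (Cube n) → α → Prop} (h : t.Traces c m Q) (D : PMF (Cube n))
    {G : Set (List (Cube n))} {E : Set α} (hE : ∀ l a, Q l a → l ∈ G → a ∈ E) :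
    (samples D m).toOuterMeasure G ≤ (t.law D c).toOuterMeasure E := by
  classical
  induction t generalizing m Q G with
  | ret a =>
    obtain ⟨rfl, h⟩ := h
    simp only [samples, Interaction.law, PMF.toOuterMeasure_pure_apply]
    split_ifs with h1 h2
    · exact le_rfl
    · exact (h2 (hE _ _ h h1)).elim
    · exact zero_le
    · exact le_rfl
  | draw k ih =>
    obtain ⟨m', rfl, h⟩ := h
    rw [samples_succ_apply, Interaction.law, PMF.toOuterMeasure_bind_apply]
    exact ENNReal.tsum_le_tsum fun x => mul_le_mul_right
      (ih _ _ (h x) fun l a hl hG => hE _ _ hl hG) _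
  | query x k ih => exact h.elim
  | random μ k ih => exact h.elim

theorem samples_forall_notMem_le {n : ℕ} (D : PMF (Cube n)) (G : Set (Cube n)) (m : ℕ) :
    (samples D m).toOuterMeasure {l | ∀ x ∈ l, x ∉ G} ≤ D.toOuterMeasure Gᶜ ^ m := by
  classical
  induction m with
  | zero =>
    simp only [samples, PMF.toOuterMeasure_pure_apply, pow_zero]
    split_ifs <;> simp
  | succ m ih =>
    rw [samples_succ_apply, pow_succ', PMF.toOuterMeasure_apply, ← ENNReal.tsum_mul_right]
    refine ENNReal.tsum_le_tsum fun x => ?_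
    by_cases hx : x ∈ G
    · simp [hx]
    · simpa [hx] using mul_le_mul_right ih (D x)

theorem one_le_toOuterMeasure_add_compl {α : Type*} (p : PMF α) (s : Set α) :
    1 ≤ p.toOuterMeasure s + p.toOuterMeasure sᶜ := by
  have h : p.toOuterMeasure Set.univ = 1 :=
    (p.toOuterMeasure_apply_eq_one_iff _).2 (Set.subset_univ _)
  rw [← h, ← Set.union_compl_self s]
  exact MeasureTheory.measure_union_le _ _

theorem toOuterMeasure_le_one {α : Type*} (p : PMF α) (s : Set α) :
    p.toOuterMeasure s ≤ 1 := by
  have h : p.toOuterMeasure Set.univ = 1 :=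
    (p.toOuterMeasure_apply_eq_one_iff _).2 (Set.subset_univ _)
  rw [← h]
  exact MeasureTheory.measure_mono (Set.subset_univ _)

open Interaction

/-! ### Loop invariants and the elimination program. -/

theorem traces_loop {n : ℕ} {c : BoolFun n} {r m : ℕ} {P : Prog} {s : State}
    (I : ℕ → List (Cube n) → State → Prop) (h0 : I 0 [] (s.tick 1))
    (hstep : ∀ j < s.reg r, ∀ l s', I j l s' →
      (P.exec n (s'.tick 1)).Traces c m fun l' s'' => I (j + 1) (l ++ l') s'') :
    ((Prog.loop r P).exec n s).Traces c (s.reg r * m) (I (s.reg r)) := by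
  rw [Prog.exec]
  have key : ∀ j ≤ s.reg r, Traces c (Nat.rec (.ret (s.tick 1))
      (fun _ t => t.bind fun s' => P.exec n (s'.tick 1)) j : Interaction n State) (j * m) (I j) := by
    intro j
    induction j with
    | zero => exact fun _ => ⟨by simp, h0⟩
    | succ j ih =>
      intro hj
      rw [Nat.succ_mul]
      exact (ih (by omega)).bind (hstep j (by omega))
  exact key _ le_rfl

/-- Nested loops whose round counts are in the registers `rs`. -/
def nest (rs : List ℕ) (P : Prog) : Prog := rs.foldr Prog.loop P

/-- The cost of nested loops with round counts `v r` whose body costs `t`. -/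
def nestCost {R : Type*} [CommSemiring R] (v : ℕ → R) (rs : List ℕ) (t : R) : R :=
  rs.foldr (fun r t => 1 + v r * (t + 1)) t

/-- The invariant has to survive ticks because the loops themselves consume time, and it has to fix
the counting registers because inner round counts are read afresh in every outer round. -/
theorem traces_nest {n : ℕ} {c : BoolFun n} {P : Prog} {m τ : ℕ} {rs : List ℕ} {v : ℕ → ℕ}
    (I : List (Cube n) → State → Prop) (hreg : ∀ l s, I l s → ∀ r ∈ rs, s.reg r = v r)
    (htick : ∀ l s t, I l s → I l (s.tick t))
    (hP : ∀ l s, I l s → (P.exec n s).Traces c m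
      fun l' s' => I (l ++ l') s' ∧ s'.time ≤ s.time + τ)
    (l : List (Cube n)) (s : State) (hs : I l s) :
    ((nest rs P).exec n s).Traces c ((rs.map v).prod * m)
      fun l' s' => I (l ++ l') s' ∧ s'.time ≤ s.time + nestCost v rs τ := by
  induction rs generalizing l s with
  | nil => simpa [nest, nestCost] using hP l s hs
  | cons r rs ih =>
    have ih' := ih fun l s h r hr => hreg l s h r (by simp [hr])
    have hr : s.reg r = v r := hreg l s hs r (by simp)
    have := traces_loop (c := c) (r := r) (m := (rs.map v).prod * m) (P := nest rs P) (s := s)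
      (fun j l' s' => I (l ++ l') s' ∧ s'.time ≤ s.time + (1 + j * (nestCost v rs τ + 1)))
      ⟨by simpa using htick _ _ _ hs, by simp [State.tick]⟩
      (fun j _ l' s' h => (ih' _ _ (htick _ _ _ h.1)).mono fun l'' s'' _ h' =>
        ⟨by simpa using h'.1, h'.2.trans (by
          have := h.2
          simp only [State.tick]
          rw [Nat.succ_mul]
          omega)⟩)
    rw [hr] at this
    simpa [nest, nestCost, mul_assoc] using this

/-- Write `1` to the heap cells of all literals, and set up the constants. -/
def setupProg (K : ℕ) : Prog :=
  .seq (.const 3 K) <| .seq (.const 5 1) <| .seq (.add 4 0 0) <| .seq (.const 6 0) <|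
    .loop 4 (.seq (.store 6 5) (.add 6 6 5))

/-- Delete the literal of one variable that the current example violates. -/
def deleteProg : Prog :=
  .seq (.load 9 8) <| .seq (.sub 10 5 9) <| .seq (.add 10 10 6) <| .seq (.const 11 0) <|
    .seq (.store 10 11) <| .seq (.add 6 6 5) <| .seq (.add 6 6 5) (.add 8 8 5)

/-- Draw an example and, if it is positive, delete the literals that it violates. -/
def exampleProg : Prog :=
  .seq (.ex 4 7) <| .ifz 7 (.const 7 0) <| .seq (.const 6 0) <| .seq (.copy 8 4) <|
    .loop 0 deleteProg

/-- The registers that count the rounds of the main loops. -/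
def loopRegs (a : ℕ) : List ℕ := 3 :: List.replicate a 0 ++ [1, 1, 1, 2]

/-- The elimination algorithm for conjunctions, on `K * n ^ a * ⌈1/ε⌉ ^ 3 * ⌈1/δ⌉` examples. -/
def learnProg (K a : ℕ) : Prog := .seq (setupProg K) (nest (loopRegs a) exampleProg)

/-- The literals that are satisfied by all positive examples in a list. -/
def consistentLits {n : ℕ} (c : BoolFun n) (l : List (Cube n)) : Set (Fin n × Bool) :=
  {p | ∀ x ∈ l, c x = true → x p.1 = p.2}

/-- The contents of the registers during the main loops. -/
def regVal (n A B K : ℕ) (r : ℕ) : ℕ :=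
  if r = 0 then n else if r = 1 then A else if r = 2 then B else if r = 3 then K else
    if r = 4 then n + n else 1

/-- The state of the elimination algorithm after the examples `l`. -/
def LearnInv {n : ℕ} (A B K : ℕ) (c : BoolFun n) (l : List (Cube n)) (s : State) : Prop :=
  (∀ r < 6, s.reg r = regVal n A B K r) ∧
    ∀ (i : Fin n) (b : Bool), s.heap (2 * i + b.toNat) ≠ 0 ↔ (i, b) ∈ consistentLits c l

theorem traces_setupProg {n : ℕ} (A B K : ℕ) (c : BoolFun n) :
    ((setupProg K).exec n (State.init n A B)).Traces c 0
      fun l s => LearnInv A B K c l s ∧ s.time ≤ 6 * n + 5 := by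
  set s₀ : State := ((((((((State.init n A B).setReg 3 K).tick 1).setReg 5 1).tick 1).setReg 4
    (n + n)).tick 1).setReg 6 0).tick 1 with hs₀
  have h : (setupProg K).exec n (State.init n A B) =
      (Prog.loop 4 (.seq (.store 6 5) (.add 6 6 5))).exec n s₀ := by
    simp [setupProg, Prog.exec, Interaction.bind, hs₀, State.init, State.setReg, State.tick]
  rw [h]
  have h4 : s₀.reg 4 = n + n := by simp [hs₀, State.setReg, State.tick]
  have := traces_loop (c := c) (r := 4) (m := 0) (P := .seq (.store 6 5) (.add 6 6 5)) (s := s₀)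
    (fun j l s => l = [] ∧ (∀ r < 6, s.reg r = regVal n A B K r) ∧ s.reg 6 = j ∧
      (∀ i < j, s.heap i ≠ 0) ∧ s.time ≤ 5 + 3 * j)
    ⟨rfl, by
      intro r hr
      interval_cases r <;> simp [hs₀, State.setReg, State.tick, State.init, regVal],
      by simp [hs₀, State.setReg, State.tick], by simp,
      by simp [hs₀, State.setReg, State.tick, State.init]⟩
    (by
      rintro j - l s ⟨rfl, hr, h6, hh, ht⟩
      have h5 : s.reg 5 = 1 := by rw [hr 5 (by omega)]; simp [regVal]
      simp only [Prog.exec, Interaction.bind, Traces, State.setReg, State.tick, State.setHeap,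
        h5, h6, true_and, List.append_nil]
      refine ⟨fun r hr' => ?_, by simp, fun i hi => ?_, by omega⟩
      · rw [Function.update_of_ne (by omega), hr r hr']
      · rcases eq_or_ne i j with rfl | hne
        · simp
        · rw [Function.update_of_ne hne]
          exact hh i (by omega))
  rw [h4, mul_zero] at this
  refine this.mono ?_
  rintro l s - ⟨rfl, hr, -, hh, ht⟩
  refine ⟨⟨hr, fun i b => iff_of_true (hh _ ?_) (by simp [consistentLits])⟩, by omega⟩
  have := i.2
  cases b <;> simp <;> omega

theorem traces_exampleProg {n : ℕ} (A B K : ℕ) (c : BoolFun n) (l : List (Cube n)) (s : State)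
    (hs : LearnInv A B K c l s) :
    (exampleProg.exec n s).Traces c 1
      fun l' s' => LearnInv A B K c (l ++ l') s' ∧ s'.time ≤ s.time + (10 * n + 6) := by
  obtain ⟨hr, hh⟩ := hs
  have h4 : s.reg 4 = n + n := by rw [hr 4 (by omega)]; simp [regVal]
  refine ⟨0, rfl, fun x => ?_⟩
  -- The example occupies cells `2n, …, 3n - 1`, the literals occupy cells below `2n`; writing one
  -- leaves the other intact.
  have hw (i : Fin n) (b : Bool) (s' : State) :
      (s'.writePoint (n + n) x).heap (2 * i + b.toNat) = s'.heap (2 * i + b.toNat) := by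
    have hi := i.2
    have : ¬ (n + n ≤ 2 * (i : ℕ) + b.toNat ∧ 2 * (i : ℕ) + b.toNat < n + n + n) := by
      cases b <;> simp <;> omega
    simp only [State.writePoint]
    rw [dif_neg this]
  have hwr (s' : State) : (s'.writePoint (n + n) x).reg = s'.reg := rfl
  have hwt (s' : State) : (s'.writePoint (n + n) x).time = s'.time := rfl
  rw [h4]
  cases hc : c x
  · simp only [Interaction.bind, Prog.exec, State.setReg, State.tick, Function.update_self,
      Bool.toNat_false, if_true, Traces, true_and]
    refine ⟨⟨fun r hr' => ?_, fun i b => ?_⟩, ?_⟩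
    · dsimp only
      rw [Function.update_of_ne (by omega), Function.update_of_ne (by omega), hwr, hr r hr']
    · rw [hw, hh]
      simp [consistentLits, or_imp, forall_and, hc]
    · simp only [hwt]; omega
  · set s₁ : State := ((((((s.writePoint (n + n) x).setReg 7 1).tick (n + 1)).tick 1).setReg 6
      0).tick 1 |>.setReg 8 (n + n)).tick 1 with hs₁
    have h0 : s₁.reg 0 = n := by
      have := hr 0 (by omega)
      simp [hs₁, State.setReg, State.tick, hwr, this, regVal]
    have he : (Prog.ifz 7 (.const 7 0) <| .seq (.const 6 0) <| .seq (.copy 8 4) <|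
        .loop 0 deleteProg).exec n (((s.writePoint (n + n) x).setReg 7 true.toNat).tick (n + 1)) =
        (Prog.loop 0 deleteProg).exec n s₁ := by
      simp [Prog.exec, Interaction.bind, hs₁, State.setReg, State.tick, hwr, h4]
    simp only [Interaction.bind]
    rw [he]
    -- After `j` rounds register 6 holds the base cell `2j` of variable `j`, register 8 points at
    -- bit `j` of the example, and exactly the variables below `j` have been filtered.
    have := traces_loop (c := c) (r := 0) (m := 0) (P := deleteProg) (s := s₁)
      (fun j l' s' => l' = [] ∧ (∀ r < 6, s'.reg r = regVal n A B K r) ∧ s'.reg 6 = j + j ∧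
        s'.reg 8 = n + n + j ∧ (∀ i : Fin n, s'.heap (n + n + i) = (x i).toNat) ∧
        (∀ (i : Fin n) (b : Bool), s'.heap (2 * i + b.toNat) ≠ 0 ↔
          (i, b) ∈ consistentLits c l ∧ ((i : ℕ) < j → x i = b)) ∧
        s'.time ≤ s.time + (n + 5 + 9 * j))
      ⟨rfl, by
        intro r hr'
        simp only [hs₁, State.setReg, State.tick]
        rw [Function.update_of_ne (by omega), Function.update_of_ne (by omega),
          Function.update_of_ne (by omega), hwr, hr r hr'],
        by simp [hs₁, State.setReg, State.tick],
        by simp [hs₁, State.setReg, State.tick],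
        fun i => by simp [hs₁, State.setReg, State.tick, State.writePoint],
        fun i b => by
          simp only [hs₁, State.setReg, State.tick, hw, hh]
          simp,
        by simp only [hs₁, State.setReg, State.tick, hwt]; omega⟩
      (by
        rintro j hj l' s' ⟨rfl, hr', h6, h8, hx, hd, ht⟩
        rw [h0] at hj
        have h5 : s'.reg 5 = 1 := by rw [hr' 5 (by omega)]; simp [regVal]
        have hxj := hx ⟨j, hj⟩
        simp only at hxj
        simp only [deleteProg, Prog.exec, Interaction.bind, Traces, State.setReg, State.tick,
          State.setHeap, true_and, List.append_nil, Function.update_self, ne_eq,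
          Nat.reduceEqDiff, not_false_eq_true, Function.update_of_ne,
          h5, h6, h8, hxj]
        -- The erased cell is a literal cell, so the stored example is not damaged.
        have hlt : 1 - (x ⟨j, hj⟩).toNat + (j + j) < n + n := by omega
        refine ⟨fun r hr'' => ?_, by omega, by omega, fun i => ?_, fun i b => ?_, by omega⟩
        · repeat rw [Function.update_of_ne (by omega)]
          exact hr' r hr''
        · rw [Function.update_of_ne (by omega), hx]
        · rcases eq_or_ne (i : ℕ) j with rfl | hne
          · by_cases hb : x i = b
            · subst hb
              rw [Function.update_of_ne (by cases x i <;> simp <;> omega), ← ne_eq, hd]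
              simp
            -- Cell `2i + (1 - x i)` is that of the violated literal of variable `i`.
            · have : 2 * (i : ℕ) + b.toNat = 1 - (x i).toNat + (i + i) := by
                cases hxi : x i <;> cases b <;> simp_all <;> omega
              rw [this, Function.update_self]
              simp [hb]
          · rw [Function.update_of_ne (by
              cases b <;> cases x ⟨j, hj⟩ <;> simp <;> omega), ← ne_eq, hd]
            have : (i : ℕ) < j + 1 ↔ (i : ℕ) < j := by omega
            rw [this])
    rw [h0, mul_zero] at this
    refine this.mono ?_
    rintro l' s' - ⟨rfl, hr', -, -, -, hd, ht⟩
    refine ⟨⟨hr', fun i b => ?_⟩, by omega⟩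
    rw [hd]
    simp [consistentLits, or_imp, forall_and, hc]

/-- The round counts of the main loops as polynomials. -/
noncomputable def regPoly (K : ℕ) (r : ℕ) : MvPolynomial (Fin 3) ℕ :=
  if r = 0 then .X 0 else if r = 1 then .X 1 else if r = 2 then .X 2 else .C K

/-- The number of examples as a polynomial. -/
noncomputable def examplePoly (K a : ℕ) : MvPolynomial (Fin 3) ℕ :=
  ((loopRegs a).map (regPoly K)).prod

/-- The running time as a polynomial. -/
noncomputable def timePoly (K a : ℕ) : MvPolynomial (Fin 3) ℕ :=
  6 * .X 0 + 5 + nestCost (regPoly K) (loopRegs a) (10 * .X 0 + 6)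

theorem regVal_eq_eval (n A B K a : ℕ) :
    ∀ r ∈ loopRegs a, regVal n A B K r = MvPolynomial.eval ![n, A, B] (regPoly K r) := by
  intro r hr
  have : r < 4 := by
    simp only [loopRegs, List.mem_append, List.mem_cons, List.mem_replicate] at hr
    grind
  interval_cases r <;> simp [regVal, regPoly]

/-- Makes evaluation of the cost polynomial `timePoly` agree with the numerical cost from
`traces_nest`. -/
theorem map_nestCost {R S : Type*} [CommSemiring R] [CommSemiring S] (f : R →+* S) (v : ℕ → R)
    (rs : List ℕ) (t : R) : f (nestCost v rs t) = nestCost (fun r => f (v r)) rs (f t) := by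
  induction rs with
  | nil => rfl
  | cons r rs ih => simpa [nestCost] using congrArg (fun y => 1 + f (v r) * (y + 1)) ih

theorem polyBound_examplePoly (K a n : ℕ) (ε δ : ℝ) :
    polyBound (examplePoly K a) n ε δ = K * n ^ a * ⌈1 / ε⌉₊ ^ 3 * ⌈1 / δ⌉₊ := by
  simp [polyBound, examplePoly, loopRegs, regPoly]
  ring

theorem traces_learnProg {n : ℕ} (K a : ℕ) (ε δ : ℝ) (c : BoolFun n) :
    ((learnProg K a).run n ε δ).Traces c (polyBound (examplePoly K a) n ε δ)
      fun l s => s.hypothesis n = conj (consistentLits c l) ∧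
        s.time ≤ polyBound (timePoly K a) n ε δ := by
  set A := ⌈1 / ε⌉₊
  set B := ⌈1 / δ⌉₊
  set v : ℕ → ℕ := fun r => MvPolynomial.eval ![n, A, B] (regPoly K r) with hv
  have hm : polyBound (examplePoly K a) n ε δ = 0 + ((loopRegs a).map v).prod * 1 := by
    simp only [polyBound, examplePoly, map_list_prod, List.map_map, mul_one, zero_add]
    rfl
  have ht : polyBound (timePoly K a) n ε δ =
      6 * n + 5 + nestCost v (loopRegs a) (10 * n + 6) := by
    simp only [polyBound, timePoly, map_add, map_mul, map_nestCost, MvPolynomial.eval_X,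
      map_ofNat]
    rfl
  rw [hm, ht]
  have hlt : ∀ r ∈ loopRegs a, r < 6 := by
    intro r hr
    simp only [loopRegs, List.mem_append, List.mem_cons, List.mem_replicate] at hr
    grind
  refine (traces_setupProg A B K c).bind fun l s hs => ?_
  refine (traces_nest (rs := loopRegs a) (v := v) (LearnInv A B K c) (fun l s h r hr => ?_)
    (fun l s t h => h) (traces_exampleProg A B K c) l s hs.1).mono fun l' s' _ h => ?_
  · rw [h.1 r (hlt r hr), regVal_eq_eval n A B K a r hr]
  · refine ⟨?_, h.2.trans (by have := hs.2; omega)⟩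
    unfold State.hypothesis
    congr 1
    ext ⟨i, b⟩
    exact h.1.2 i b

/-! ### Tail bounds for the uniform distribution. -/

theorem uniform_toOuterMeasure_apply {n : ℕ} (S : Set (Cube n)) [DecidablePred (· ∈ S)] :
    (uniform n).toOuterMeasure S =
      ENNReal.ofReal ((Finset.univ.filter (· ∈ S)).card / 2 ^ n) := by
  rw [uniform, PMF.toOuterMeasure_uniformOfFintype_apply, ENNReal.ofReal_div_of_pos (by positivity),
    ENNReal.ofReal_natCast, Fintype.card_subtype]
  congr 1
  rw [ENNReal.ofReal_pow (by norm_num)]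
  simp

/-- The tail bound for the number of coordinates in `F` at which a random point differs from a
given one. -/
theorem uniform_card_ne_le {n : ℕ} (F : Finset (Fin n)) (y : Cube n) (r : ℝ) :
    (uniform n).toOuterMeasure {x | ((F.filter fun i => x i ≠ y i).card : ℝ) ≤ r} ≤
      ENNReal.ofReal (2 ^ r * (3 / 4) ^ F.card) := by
  classical
  rw [uniform_toOuterMeasure_apply]
  refine ENNReal.ofReal_le_ofReal ?_
  rw [div_le_iff₀ (by positivity)]
  have hprod (x : Cube n) : (1 / 2 : ℝ) ^ (F.filter fun i => x i ≠ y i).card =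
      ∏ i, (if i ∈ F ∧ x i ≠ y i then (1 / 2 : ℝ) else 1) := by
    rw [Finset.prod_ite, Finset.prod_const, Finset.prod_const_one, mul_one]
    congr 2
    ext i
    simp
  -- The weight factorizes over coordinates; each one in `F` has mean `(1 + 1/2)/2 = 3/4`.
  have hsum : ∑ x : Cube n, (1 / 2 : ℝ) ^ (F.filter fun i => x i ≠ y i).card =
      (3 / 4) ^ F.card * 2 ^ n := by
    simp_rw [hprod]
    rw [← Fintype.prod_sum fun (i : Fin n) (b : Bool) =>
      if i ∈ F ∧ b ≠ y i then (1 / 2 : ℝ) else 1]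
    have hi (i : Fin n) : ∑ b : Bool, (if i ∈ F ∧ b ≠ y i then (1 / 2 : ℝ) else 1) =
        (if i ∈ F then (3 / 4 : ℝ) else 1) * 2 := by
      by_cases h : i ∈ F <;> cases y i <;> simp [h] <;> norm_num
    simp_rw [hi]
    rw [Finset.prod_mul_distrib, Finset.prod_ite_mem]
    simp [div_pow]
  -- Markov's inequality: on the event, `2^r (1/2)^count` is at least `1`.
  have hle : ((Finset.univ.filter
      (· ∈ {x : Cube n | ((F.filter fun i => x i ≠ y i).card : ℝ) ≤ r})).card : ℝ) ≤
      ∑ x : Cube n, 2 ^ r * (1 / 2 : ℝ) ^ (F.filter fun i => x i ≠ y i).card := by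
    rw [Finset.card_filter, Nat.cast_sum]
    refine Finset.sum_le_sum fun x _ => ?_
    by_cases hx : ((F.filter fun i => x i ≠ y i).card : ℝ) ≤ r
    · simp only [Set.mem_ofPred_eq, hx, if_true, Nat.cast_one]
      rw [one_div, inv_pow, ← div_eq_mul_inv, le_div_iff₀ (by positivity), one_mul,
        ← Real.rpow_natCast]
      exact Real.rpow_le_rpow_of_exponent_le (by norm_num) hx
    · simp only [Set.mem_ofPred_eq, hx, if_false, Nat.cast_zero]
      positivity
  rw [← Finset.mul_sum, hsum] at hle
  linarith

theorem uniform_compl_cylinder {n : ℕ} (F : Finset (Fin n)) (y : Cube n) :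
    (uniform n).toOuterMeasure {x | ∀ i ∈ F, x i = y i}ᶜ =
      ENNReal.ofReal (1 - (1 / 2) ^ F.card) := by
  classical
  have hcard : ((Finset.univ.filter (· ∈ {x : Cube n | ∀ i ∈ F, x i = y i})).card : ℝ) =
      (1 / 2) ^ F.card * 2 ^ n := by
    have hprod (x : Cube n) : (if x ∈ {x : Cube n | ∀ i ∈ F, x i = y i} then (1 : ℝ) else 0) =
        ∏ i, (if i ∈ F → x i = y i then (1 : ℝ) else 0) := by
      rw [Finset.prod_boole]
      simp
    rw [Finset.card_filter]
    push_cast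
    simp_rw [hprod]
    rw [← Fintype.prod_sum fun (i : Fin n) (b : Bool) => if i ∈ F → b = y i then (1 : ℝ) else 0]
    have hi (i : Fin n) : ∑ b : Bool, (if i ∈ F → b = y i then (1 : ℝ) else 0) =
        (if i ∈ F then (1 / 2 : ℝ) else 1) * 2 := by
      by_cases h : i ∈ F <;> cases y i <;> simp [h]
    simp_rw [hi]
    rw [Finset.prod_mul_distrib, Finset.prod_ite_mem]
    simp
  have hadd := Finset.card_filter_add_card_filter_not (s := (Finset.univ : Finset (Cube n)))
    (· ∈ {x : Cube n | ∀ i ∈ F, x i = y i})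
  rw [uniform_toOuterMeasure_apply]
  congr 1
  rw [div_eq_iff (by positivity), sub_mul, one_mul, ← hcard, eq_sub_iff_add_eq, add_comm]
  simp only [Finset.card_univ, Fintype.card_fun, Fintype.card_bool, Fintype.card_fin] at hadd
  exact_mod_cast hadd

/-- Bernoulli gives `p m ≤ (1 + p)^m`, and `(1 - p)(1 + p) ≤ 1`. This replaces the exponential bound
on `(1 - p)^m`, at the price of a sample size linear, not logarithmic, in `1/δ`. -/
theorem one_sub_pow_mul_le {p : ℝ} (h0 : 0 ≤ p) (h1 : p ≤ 1) (m : ℕ) :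
    (1 - p) ^ m * (p * m) ≤ 1 := by
  have hb : 1 + m * p ≤ (1 + p) ^ m := one_add_mul_le_pow (by linarith) m
  have hp : (0 : ℝ) ≤ (1 - p) ^ m := pow_nonneg (by linarith) m
  calc (1 - p) ^ m * (p * m) ≤ (1 - p) ^ m * (1 + p) ^ m := by gcongr; linarith
    _ = (1 - p ^ 2) ^ m := by rw [← mul_pow]; ring
    _ ≤ 1 := pow_le_one₀ (by nlinarith) (by nlinarith [sq_nonneg p])

/-! ### Robust risk of the elimination algorithm. -/

theorem conj_eq_true_iff {n : ℕ} (L : Set (Fin n × Bool)) (x : Cube n) :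
    conj L x = true ↔ ∀ p ∈ L, x p.1 = p.2 := by
  simp [conj]

theorem robustRisk_self {n : ℕ} (D : PMF (Cube n)) (r : ℝ) (c : BoolFun n) :
    robustRisk D r c c = 0 := by
  simp [robustRisk]

theorem subset_consistentLits {n : ℕ} (L : Set (Fin n × Bool)) (l : List (Cube n)) :
    L ⊆ consistentLits (conj L) l :=
  fun p hp x _ hx => (conj_eq_true_iff L x).1 hx p hp

/-- A hypothesis that implies a long conjunction has small robust risk. -/
theorem robustRisk_le_of_subset {n : ℕ} {L H : Set (Fin n × Bool)} (hLH : L ⊆ H)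
    (F : Finset (Fin n)) (y : Cube n) (hF : ∀ x, conj L x = true → ∀ i ∈ F, x i = y i) (r : ℝ) :
    robustRisk (uniform n) r (conj H) (conj L) ≤ ENNReal.ofReal (2 ^ r * (3 / 4) ^ F.card) := by
  refine le_trans (MeasureTheory.measure_mono ?_) (uniform_card_ne_le F y r)
  rintro x ⟨z, hz, hne⟩
  have hcz : conj L z = true := by
    by_contra h
    refine hne ?_
    have h' : ¬ conj H z = true := fun hH => h <| (conj_eq_true_iff _ _).2 fun p hp =>
      (conj_eq_true_iff _ _).1 hH p (hLH hp)
    rw [Bool.not_eq_true] at h h'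
    rw [h, h']
  refine le_trans ?_ hz
  exact_mod_cast Finset.card_le_card fun i hi => by
    rw [Finset.mem_filter] at hi
    simpa [hF z hcz i hi.1] using hi.2

/-- The elimination algorithm finds a satisfiable conjunction of `k` literals exactly, up to a
failure probability of `2 n (1 - 2⁻ᵏ⁻¹) ^ m`. -/
theorem samples_consistentLits_ne_le {n : ℕ} {L : Set (Fin n × Bool)} (F : Finset (Fin n))
    (y : Cube n) (hF : ∀ i b, (i, b) ∈ L ↔ i ∈ F ∧ b = y i) (m : ℕ) :
    (samples (uniform n) m).toOuterMeasure {l | consistentLits (conj L) l ≠ L} ≤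
      ENNReal.ofReal (2 * n * (1 - (1 / 2) ^ (F.card + 1)) ^ m) := by
  classical
  have hconj (x : Cube n) : conj L x = true ↔ ∀ i ∈ F, x i = y i := by
    rw [conj_eq_true_iff]
    constructor
    · exact fun h i hi => h (i, y i) ((hF _ _).2 ⟨hi, rfl⟩)
    · rintro h ⟨i, b⟩ hp
      obtain ⟨hi, rfl⟩ := (hF i b).1 hp
      exact h i hi
  have hp0 (k : ℕ) : (0 : ℝ) ≤ 1 - (1 / 2) ^ k := by
    linarith [pow_le_one₀ (n := k) (show (0 : ℝ) ≤ 1 / 2 by norm_num) (by norm_num)]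
  have hlit (p : Fin n × Bool) (hp : p ∉ L) :
      (samples (uniform n) m).toOuterMeasure {l | p ∈ consistentLits (conj L) l} ≤
        ENNReal.ofReal ((1 - (1 / 2) ^ (F.card + 1)) ^ m) := by
    obtain ⟨i, b⟩ := p
    -- On the cylinder of `y'` over `insert i F` every point is positive and violates `(i, b)`. For
    -- `i ∈ F` this is automatic, since `(i, b) ∉ L` forces `b ≠ y i`; otherwise bit `i` is set to
    -- `!b`.
    set y' : Cube n := if i ∈ F then y else Function.update y i (!b) with hy'
    have hsub : {x : Cube n | ∀ j ∈ insert i F, x j = y' j} ⊆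
        {x | conj L x = true ∧ x i ≠ b} := by
      intro x hx
      by_cases hi : i ∈ F
      · simp only [hi, if_true, Finset.insert_eq_of_mem, Set.mem_ofPred_eq, y'] at hx
        refine ⟨(hconj x).2 hx, fun hb => hp ((hF i b).2 ⟨hi, ?_⟩)⟩
        rw [← hb, hx i hi]
      · simp only [hi, if_false, Set.mem_ofPred_eq, y'] at hx
        refine ⟨(hconj x).2 fun j hj => ?_, ?_⟩
        · rw [hx j (Finset.mem_insert_of_mem hj), Function.update_of_ne]
          rintro rfl
          exact hi hj
        · rw [hx i (Finset.mem_insert_self _ _)]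
          simp
    calc (samples (uniform n) m).toOuterMeasure {l | (i, b) ∈ consistentLits (conj L) l}
        ≤ (samples (uniform n) m).toOuterMeasure
            {l | ∀ x ∈ l, x ∉ {x : Cube n | ∀ j ∈ insert i F, x j = y' j}} := by
          refine MeasureTheory.measure_mono fun l hl x hx hx' => ?_
          exact (hsub hx').2 (hl x hx (hsub hx').1)
      _ ≤ _ := samples_forall_notMem_le _ _ _
      _ ≤ _ := by
          rw [uniform_compl_cylinder, ← ENNReal.ofReal_pow (hp0 _)]
          refine ENNReal.ofReal_le_ofReal (pow_le_pow_left₀ (hp0 _) ?_ _)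
          have := pow_le_pow_of_le_one (show (0 : ℝ) ≤ 1 / 2 by norm_num) (by norm_num)
            (Finset.card_insert_le i F)
          linarith
  -- Union bound over the at most `2n` literals outside `L`.
  calc (samples (uniform n) m).toOuterMeasure {l | consistentLits (conj L) l ≠ L}
      ≤ (samples (uniform n) m).toOuterMeasure
          (⋃ p ∈ Finset.univ.filter (· ∉ L), {l | p ∈ consistentLits (conj L) l}) := by
        refine MeasureTheory.measure_mono fun l hl => ?_
        by_contra hcon
        refine hl (Set.Subset.antisymm (fun p hp => ?_) (subset_consistentLits L l))
        by_contra hpL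
        exact hcon (Set.mem_biUnion (x := p) (by simp [hpL]) hp)
    _ ≤ ∑ p ∈ Finset.univ.filter (· ∉ L),
          (samples (uniform n) m).toOuterMeasure {l | p ∈ consistentLits (conj L) l} :=
        MeasureTheory.measure_biUnion_finset_le _ _
    _ ≤ ∑ p ∈ Finset.univ.filter (· ∉ L), ENNReal.ofReal ((1 - (1 / 2) ^ (F.card + 1)) ^ m) :=
        Finset.sum_le_sum fun p hp => hlit p (Finset.mem_filter.1 hp).2
    _ ≤ ∑ p : Fin n × Bool, ENNReal.ofReal ((1 - (1 / 2) ^ (F.card + 1)) ^ m) :=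
        Finset.sum_le_sum_of_subset (Finset.filter_subset _ _)
    _ = _ := by
        rw [Finset.sum_const, Finset.card_univ, Fintype.card_prod, Fintype.card_fin,
          Fintype.card_bool, nsmul_eq_mul, ← ENNReal.ofReal_natCast,
          ← ENNReal.ofReal_mul (by positivity)]
        push_cast
        ring_nf

theorem ofReal_one_sub_le_of_compl_le {α : Type*} (p : PMF α) (s : Set α) {δ : ℝ} (hδ : 0 ≤ δ)
    (h : p.toOuterMeasure sᶜ ≤ ENNReal.ofReal δ) :
    ENNReal.ofReal (1 - δ) ≤ p.toOuterMeasure s := by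
  rw [ENNReal.ofReal_sub _ hδ, ENNReal.ofReal_one, tsub_le_iff_right]
  exact (one_le_toOuterMeasure_add_compl p s).trans (add_le_add_right h _)

/-- The elimination algorithm is a robust learner. -/
theorem le_samples_robustRisk_le {n : ℕ} {c : BoolFun n} (hc : c ∈ Conjunctions n)
    {r ε δ : ℝ} (hε : 0 < ε) (hδ : 0 < δ) {m : ℕ}
    (hm : 4 * n * (2 ^ r) ^ 3 * (⌈1 / ε⌉₊ : ℝ) ^ 3 * ⌈1 / δ⌉₊ ≤ m) :
    ENNReal.ofReal (1 - δ) ≤ (samples (uniform n) m).toOuterMeasure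
      {l | robustRisk (uniform n) r (conj (consistentLits c l)) c ≤ ENNReal.ofReal ε} := by
  classical
  obtain ⟨L, rfl⟩ := hc
  refine ofReal_one_sub_le_of_compl_le _ _ hδ.le ?_
  have hA : 1 / ε ≤ (⌈1 / ε⌉₊ : ℝ) := Nat.le_ceil _
  have hB : 1 / δ ≤ (⌈1 / δ⌉₊ : ℝ) := Nat.le_ceil _
  set A : ℝ := (⌈1 / ε⌉₊ : ℝ)
  set B : ℝ := (⌈1 / δ⌉₊ : ℝ)
  have hA0 : 0 < A := lt_of_lt_of_le (by positivity) hA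
  have hB0 : 0 < B := lt_of_lt_of_le (by positivity) hB
  by_cases hsat : ∃ y, conj L y = true
  · obtain ⟨y, hy⟩ := hsat
    set F : Finset (Fin n) := Finset.univ.filter fun i => (i, y i) ∈ L with hFdef
    have hF (i : Fin n) (b : Bool) : (i, b) ∈ L ↔ i ∈ F ∧ b = y i := by
      constructor
      · intro h
        have hb : y i = b := (conj_eq_true_iff L y).1 hy _ h
        exact ⟨by simpa [hFdef, hb] using h, hb.symm⟩
      · rintro ⟨h, rfl⟩
        simpa [hFdef] using h
    -- Long targets are robustly approximated by any hypothesis implying them; short ones are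
    -- learned exactly.
    rcases le_or_gt (2 ^ r * (3 / 4 : ℝ) ^ F.card) ε with hlong | hshort
    · have hempty : {l | robustRisk (uniform n) r (conj (consistentLits (conj L) l)) (conj L) ≤
          ENNReal.ofReal ε}ᶜ = ∅ := by
        rw [Set.compl_empty_iff, Set.eq_univ_iff_forall]
        refine fun l => (robustRisk_le_of_subset (subset_consistentLits L l) F y
          (fun x hx i hi => ?_) r).trans (ENNReal.ofReal_le_ofReal hlong)
        exact (conj_eq_true_iff L x).1 hx (i, y i) ((hF _ _).2 ⟨hi, rfl⟩)
      rw [hempty]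
      simp
    · refine le_trans (MeasureTheory.measure_mono
        (t := {l | consistentLits (conj L) l ≠ L}) fun l hl hL => hl ?_)
        ((samples_consistentLits_ne_le F y hF m).trans (ENNReal.ofReal_le_ofReal ?_))
      · rw [Set.mem_ofPred_eq, hL, robustRisk_self]
        exact zero_le
      · have hR : (0 : ℝ) < 2 ^ r := by positivity
        have h43 : (4 / 3 : ℝ) ^ F.card ≤ 2 ^ r * A := by
          have h1 : (4 / 3 : ℝ) ^ F.card * (3 / 4) ^ F.card = 1 := by
            rw [← mul_pow]; norm_num
          have h2 : 1 ≤ A * ε := by rwa [div_le_iff₀ hε] at hA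
          have h3 : (4 / 3 : ℝ) ^ F.card * ε ≤ 2 ^ r := by
            calc (4 / 3 : ℝ) ^ F.card * ε ≤ (4 / 3 : ℝ) ^ F.card * (2 ^ r * (3 / 4) ^ F.card) := by
                  gcongr
              _ = 2 ^ r * ((4 / 3 : ℝ) ^ F.card * (3 / 4) ^ F.card) := by ring
              _ = 2 ^ r := by rw [h1, mul_one]
          calc (4 / 3 : ℝ) ^ F.card ≤ (4 / 3 : ℝ) ^ F.card * (A * ε) :=
                le_mul_of_one_le_right (by positivity) h2
            _ = ((4 / 3 : ℝ) ^ F.card * ε) * A := by ring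
            _ ≤ 2 ^ r * A := by gcongr
        -- The cube in the sample size comes from `(4/3)^3 = 64/27 ≥ 2`.
        have h2k : (2 : ℝ) ^ F.card ≤ (2 ^ r * A) ^ 3 := by
          calc (2 : ℝ) ^ F.card ≤ ((4 / 3 : ℝ) ^ 3) ^ F.card :=
                pow_le_pow_left₀ (by norm_num) (by norm_num) _
            _ = ((4 / 3 : ℝ) ^ F.card) ^ 3 := by rw [← pow_mul, ← pow_mul, mul_comm]
            _ ≤ _ := pow_le_pow_left₀ (by positivity) h43 _
        have hp1 : (1 / 2 : ℝ) ^ (F.card + 1) ≤ 1 := pow_le_one₀ (by norm_num) (by norm_num)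
        have hX := one_sub_pow_mul_le (show (0 : ℝ) ≤ (1 / 2) ^ (F.card + 1) by positivity) hp1 m
        have hX0 : (0 : ℝ) ≤ (1 - (1 / 2) ^ (F.card + 1)) ^ m := pow_nonneg (by linarith) _
        set X : ℝ := (1 - (1 / 2) ^ (F.card + 1)) ^ m
        have hpm : 2 * n * B ≤ (1 / 2 : ℝ) ^ (F.card + 1) * m := by
          have h1 : 4 * n * 2 ^ F.card * B ≤ (m : ℝ) := by
            refine le_trans ?_ hm
            calc 4 * n * 2 ^ F.card * B ≤ 4 * n * (2 ^ r * A) ^ 3 * B := by gcongr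
              _ = _ := by ring
          calc 2 * n * B = (1 / 2 : ℝ) ^ (F.card + 1) * (4 * n * 2 ^ F.card * B) := by
                have : (1 / 2 : ℝ) ^ F.card * 2 ^ F.card = 1 := by rw [← mul_pow]; norm_num
                rw [pow_succ]
                linear_combination (-2 * n * B) * this
            _ ≤ _ := by gcongr
        have hfin : 2 * n * X * B ≤ 1 := by
          calc 2 * n * X * B = X * (2 * n * B) := by ring
            _ ≤ X * ((1 / 2 : ℝ) ^ (F.card + 1) * m) := by gcongr
            _ ≤ 1 := hX
        have hBδ : 1 ≤ B * δ := by rwa [div_le_iff₀ hδ] at hB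
        by_contra hcon
        rw [not_le] at hcon
        nlinarith
  -- An unsatisfiable target has no positive examples, so all literals survive and contradict each
  -- other. Here `n > 0`, because in dimension `0` every conjunction is true.
  · have hfalse (x : Cube n) : conj L x = false := by
      simpa using not_exists.1 hsat x
    have hn : 0 < n := by
      rcases Nat.eq_zero_or_pos n with rfl | h
      · exact (hsat ⟨fun _ => true, (conj_eq_true_iff _ _).2 fun p => p.1.elim0⟩).elim
      · exact h
    have hempty : {l | robustRisk (uniform n) r (conj (consistentLits (conj L) l)) (conj L) ≤
        ENNReal.ofReal ε}ᶜ = ∅ := by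
      rw [Set.compl_empty_iff, Set.eq_univ_iff_forall]
      intro l
      have : conj (consistentLits (conj L) l) = conj L := by
        funext x
        rw [hfalse x, ← Bool.not_eq_true, conj_eq_true_iff]
        intro h
        have h1 := h (⟨0, hn⟩, true) (by simp [consistentLits, hfalse])
        have h2 := h (⟨0, hn⟩, false) (by simp [consistentLits, hfalse])
        simp_all
      rw [Set.mem_ofPred_eq, this, robustRisk_self]
      exact zero_le
    rw [hempty]
    simp

/-- The exponent `a` comes from the asymptotic bound; `K` absorbs the finitely many dimensions below
its range. -/
theorem exists_two_rpow_le {ρ : ℕ → ℝ} (hρ : ρ =O[atTop] fun n : ℕ => Real.log n) :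
    ∃ K a : ℕ, ∀ n : ℕ, 0 < n → (2 : ℝ) ^ ρ n ≤ K * (n : ℝ) ^ a := by
  obtain ⟨C, hC⟩ := hρ.bound
  obtain ⟨N, hN⟩ := eventually_atTop.1 hC
  refine ⟨1 + ∑ n ∈ Finset.range N, ⌈(2 : ℝ) ^ ρ n⌉₊, ⌈C⌉₊, fun n hn => ?_⟩
  have hn1 : (1 : ℝ) ≤ n := by exact_mod_cast hn
  rcases lt_or_ge n N with h | h
  · have h1 : ⌈(2 : ℝ) ^ ρ n⌉₊ ≤ ∑ n ∈ Finset.range N, ⌈(2 : ℝ) ^ ρ n⌉₊ :=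
      Finset.single_le_sum (f := fun n => ⌈(2 : ℝ) ^ ρ n⌉₊) (fun _ _ => Nat.zero_le _)
        (Finset.mem_range.2 h)
    calc (2 : ℝ) ^ ρ n ≤ ⌈(2 : ℝ) ^ ρ n⌉₊ := Nat.le_ceil _
      _ ≤ ((1 + ∑ n ∈ Finset.range N, ⌈(2 : ℝ) ^ ρ n⌉₊ : ℕ) : ℝ) := by
          exact_mod_cast h1.trans (Nat.le_add_left _ _)
      _ ≤ _ := le_mul_of_one_le_right (by positivity) (one_le_pow₀ hn1)
  · have hlog : 0 ≤ Real.log n := Real.log_natCast_nonneg n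
    have h1 : ρ n ≤ ⌈C⌉₊ * Real.log n := by
      have := hN n h
      rw [Real.norm_of_nonneg hlog] at this
      exact (le_abs_self _).trans (this.trans (mul_le_mul_of_nonneg_right (Nat.le_ceil C) hlog))
    have h2 : (2 : ℝ) ^ ρ n ≤ (n : ℝ) ^ ⌈C⌉₊ := by
      rw [Real.rpow_def_of_pos (by norm_num), ← Real.rpow_natCast,
        Real.rpow_def_of_pos (by linarith), Real.exp_le_exp]
      have hl2 : Real.log 2 ≤ 1 := by linarith [Real.log_two_lt_d9]
      have hl0 : 0 ≤ Real.log 2 := Real.log_nonneg (by norm_num)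
      calc Real.log 2 * ρ n ≤ Real.log 2 * (⌈C⌉₊ * Real.log n) := by gcongr
        _ ≤ 1 * (⌈C⌉₊ * Real.log n) := by gcongr
        _ = _ := by ring
    refine h2.trans (le_mul_of_one_le_left (by positivity) ?_)
    push_cast
    exact le_add_of_nonneg_right (by positivity)

/-- The elimination algorithm with suitable constants has enough examples for the budget `ρ`. -/
theorem exists_learnProg {ρ : ℕ → ℝ} (hρ : ρ =O[atTop] fun n : ℕ => Real.log n) :
    ∃ K a : ℕ, ∀ (n : ℕ) (ε δ : ℝ), 0 < ε → 0 < δ → ∀ c ∈ Conjunctions n,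
      Succeeds (uniform n) (ρ n) ε δ c
        (((learnProg K a).run n ε δ).bind fun s => .ret (s.hypothesis n)) := by
  obtain ⟨K, a, h⟩ := exists_two_rpow_le hρ
  -- These constants match `4 n (K n^a)^3`, the requirement of `le_samples_robustRisk_le`.
  refine ⟨4 * K ^ 3, 3 * a + 1, fun n ε δ hε hδ c hc => ?_⟩
  have ht : (((learnProg (4 * K ^ 3) (3 * a + 1)).run n ε δ).bind
      fun s => .ret (s.hypothesis n)).Traces c
      (polyBound (examplePoly (4 * K ^ 3) (3 * a + 1)) n ε δ + 0)
      fun l h => h = conj (consistentLits c l) :=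
    (traces_learnProg _ _ ε δ c).bind fun l s hs => ⟨rfl, by simpa using hs.1⟩
  refine (le_samples_robustRisk_le (r := ρ n) hc hε hδ ?_).trans (ht.le_law (uniform n) ?_)
  · rw [add_zero, polyBound_examplePoly]
    push_cast
    rcases Nat.eq_zero_or_pos n with rfl | hn
    · simp
    · calc 4 * n * (2 ^ ρ n) ^ 3 * (⌈1 / ε⌉₊ : ℝ) ^ 3 * ⌈1 / δ⌉₊
          ≤ 4 * n * (K * (n : ℝ) ^ a) ^ 3 * (⌈1 / ε⌉₊ : ℝ) ^ 3 * ⌈1 / δ⌉₊ := by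
            gcongr
            exact h n hn
        _ = _ := by ring
  · rintro l _ rfl hl
    exact hl

theorem polyTimeLearnable_conjunctions (lam : ℕ → ℝ) {ρ : ℕ → ℝ}
    (hρ : ρ =O[atTop] fun n : ℕ => Real.log n) :
    PolyTimeLearnable uniform Conjunctions lam ρ := by
  obtain ⟨K, a, h⟩ := exists_learnProg hρ
  exact ⟨learnProg K a, timePoly K a, fun n ε δ hε hδ c hc =>
    ⟨(traces_learnProg K a ε δ c).always fun _ _ hs => hs.2,
      (traces_learnProg K a ε δ c).isLocal _ _, h n ε δ hε hδ c hc⟩⟩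

theorem sampleEfficientlyLearnable_conjunctions (lam : ℕ → ℝ) {ρ : ℕ → ℝ}
    (hρ : ρ =O[atTop] fun n : ℕ => Real.log n) :
    SampleEfficientlyLearnable uniform Conjunctions lam ρ := by
  obtain ⟨K, a, h⟩ := exists_learnProg hρ
  refine ⟨fun n ε δ => ((learnProg K a).run n ε δ).bind fun s => .ret (s.hypothesis n),
    examplePoly K a, fun n ε δ hε hδ c hc => ?_⟩
  have ht := (traces_learnProg K a ε δ c).bind (m' := 0) (Q' := fun _ _ => True)
    (f := fun s => .ret (s.hypothesis n)) fun l s _ => ⟨rfl, trivial⟩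
  exact ⟨ht.examplesAtMost, ht.queriesAtMost _, ht.isLocal _ _, h n ε δ hε hδ c hc⟩

/-! ### Lower bound: indistinguishable targets. -/

/-- Averaging over a random choice preserves the additive error `C`, since `p` has total mass `1`.
-/
theorem sum_tsum_le {ι β : Type} [Fintype ι] (p : PMF β) (f g : ι → β → ENNReal) (C : ENNReal)
    (h : ∀ b ∈ p.support, ∑ s, f s b ≤ ∑ s, g s b + C) :
    ∑ s, ∑' b, p b * f s b ≤ ∑ s, ∑' b, p b * g s b + C := by
  have hC : C = ∑' b, p b * C := by rw [ENNReal.tsum_mul_right, p.tsum_coe, one_mul]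
  rw [← Summable.tsum_finsetSum fun _ _ => ENNReal.summable,
    ← Summable.tsum_finsetSum fun _ _ => ENNReal.summable]
  nth_rewrite 1 [hC]
  rw [← ENNReal.tsum_add]
  refine ENNReal.tsum_le_tsum fun b => ?_
  rw [← Finset.mul_sum, ← Finset.mul_sum, ← mul_add]
  by_cases hb : b ∈ p.support
  · exact mul_le_mul_right (h b hb) _
  · simp [(p.apply_eq_zero_iff b).2 hb]

/-- If no point is accepted by two of the targets `cs s`, then a procedure with few oracle calls
cannot tell most of them from the constant `false`. -/
theorem sum_law_le {n : ℕ} {α ι : Type} [Fintype ι] (D : PMF (Cube n)) (cs : ι → BoolFun n)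
    (hcs : ∀ x s s', cs s x = true → cs s' x = true → s = s') (E : ι → Set α)
    (t : Interaction n α) (m q : ℕ) (hm : t.ExamplesAtMost (fun _ => false) m)
    (hq : t.QueriesAtMost (fun _ => false) q) :
    ∑ s, (t.law D (cs s)).toOuterMeasure (E s) ≤
      ∑ s, (t.law D fun _ => false).toOuterMeasure (E s) + (m + q : ℕ) := by
  classical
  -- At most one target accepts `x`; replacing its answer by `false` costs at most `1` in the sum,
  -- as each term is a probability.
  have step (x : Cube n) (k : Bool → Interaction n α) :
      ∑ s, ((k (cs s x)).law D (cs s)).toOuterMeasure (E s) ≤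
        ∑ s, ((k false).law D (cs s)).toOuterMeasure (E s) + 1 := by
    have h1 : ∑ s, (if cs s x = true then (1 : ENNReal) else 0) ≤ 1 := by
      rw [Finset.sum_boole]
      exact_mod_cast Finset.card_le_one.2 fun a ha b hb =>
        hcs x a b (Finset.mem_filter.1 ha).2 (Finset.mem_filter.1 hb).2
    refine le_trans ?_ (add_le_add_right h1 _)
    rw [← Finset.sum_add_distrib]
    refine Finset.sum_le_sum fun s _ => ?_
    cases hx : cs s x
    · simp
    · simpa using le_add_left (toOuterMeasure_le_one _ _)
  induction t generalizing m q with
  | ret a => exact le_self_add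
  | draw k ih =>
    obtain ⟨m', rfl, hm⟩ := hm
    simp only [Interaction.law, PMF.toOuterMeasure_bind_apply]
    refine sum_tsum_le D _ _ _ fun x _ => (step x (k x)).trans ?_
    refine (add_le_add_left (ih x false m' q (hm x) (hq x)) 1).trans (le_of_eq ?_)
    push_cast; ring
  | query x k ih =>
    obtain ⟨q', rfl, hq⟩ := hq
    refine (step x k).trans ?_
    refine (add_le_add_left (ih false m q' hm hq) 1).trans (le_of_eq ?_)
    simp only [Interaction.law]
    push_cast; ring
  | random μ k ih =>
    simp only [Interaction.law, PMF.toOuterMeasure_bind_apply]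
    exact sum_tsum_le μ _ _ _ fun i hi => ih i m q (hm i hi) (hq i hi)

/-- The literals that prescribe the first coordinates of a point. -/
def prefixLits {n l : ℕ} (hl : l ≤ n) (s : Cube l) : Set (Fin n × Bool) :=
  Set.range fun j : Fin l => (Fin.castLE hl j, s j)

theorem conj_prefixLits {n l : ℕ} (hl : l ≤ n) (s : Cube l) (x : Cube n) :
    conj (prefixLits hl s) x = true ↔ ∀ j, x (Fin.castLE hl j) = s j := by
  simp [conj, prefixLits]

theorem false_mem_conjunctions {n : ℕ} (hn : 0 < n) :
    (fun _ => false) ∈ Conjunctions n := by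
  refine ⟨Set.univ, ?_⟩
  funext x
  simp only [conj, Set.mem_univ, true_imp_iff]
  rw [eq_comm, decide_eq_false_iff_not]
  intro h
  have h1 := h (⟨0, hn⟩, true)
  have h2 := h (⟨0, hn⟩, false)
  simp_all

theorem exists_near_prefixLits {n l : ℕ} (hl : l ≤ n) (s : Cube l) (x : Cube n) :
    ∃ z, hammingDist x z ≤ l ∧ conj (prefixLits hl s) z = true := by
  classical
  refine ⟨fun i => if h : (i : ℕ) < l then s ⟨i, h⟩ else x i, ?_, ?_⟩
  · refine (Finset.card_le_card (t := Finset.univ.image (Fin.castLE hl)) fun i hi => ?_).trans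
      (Finset.card_image_le.trans (by simp))
    by_cases h : (i : ℕ) < l
    · exact Finset.mem_image.2 ⟨⟨i, h⟩, by simp, by ext; simp⟩
    · simp [h] at hi
  · rw [conj_prefixLits]
    intro j
    simp

/-- Overwriting the first `l` bits of any `x` gives a nearby `z` at which the two targets disagree,
so `h` is wrong there for one of them. -/
theorem one_le_robustRisk_add {n l : ℕ} (hl : l ≤ n) (s : Cube l) (D : PMF (Cube n)) {r : ℝ}
    (hr : (l : ℝ) ≤ r) (h : BoolFun n) :
    1 ≤ robustRisk D r h (fun _ => false) + robustRisk D r h (conj (prefixLits hl s)) := by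
  refine (one_le_toOuterMeasure_add_compl D _).trans
    (add_le_add_right (MeasureTheory.measure_mono fun x hx => ?_) _)
  obtain ⟨z, hz, hc⟩ := exists_near_prefixLits hl s x
  have hz' : (hammingDist x z : ℝ) ≤ r := le_trans (by exact_mod_cast hz) hr
  refine ⟨z, hz', fun he => hx ⟨z, hz', ?_⟩⟩
  rw [← he, hc]
  simp

/-- Summing over the `2^l` prefixes gives `(3/4) 2^l ≤ (1/4) 2^l + m + q`. -/
theorem two_pow_le_of_succeeds {n l : ℕ} (hl : l ≤ n) (hn : 0 < n) {r : ℝ} (hr : (l : ℝ) ≤ r)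
    (A : Learner n) (hA : ∀ c ∈ Conjunctions n, Succeeds (uniform n) r (1 / 4) (1 / 4) c A)
    (m q : ℕ) (hm : A.ExamplesAtMost (fun _ => false) m)
    (hq : A.QueriesAtMost (fun _ => false) q) : 2 ^ l ≤ 2 * (m + q) := by
  classical
  set D := uniform n
  let E (c : BoolFun n) : Set (BoolFun n) := {h | robustRisk D r h c ≤ ENNReal.ofReal (1 / 4)}
  have hsum := sum_law_le D (fun s : Cube l => conj (prefixLits hl s))
    (fun x s s' h h' => by
      rw [conj_prefixLits] at h h'
      funext j
      rw [← h, ← h']) (fun s => E (conj (prefixLits hl s))) A m q hm hq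
  have hlow : ∀ s : Cube l, ENNReal.ofReal (3 / 4) ≤
      (A.law D (conj (prefixLits hl s))).toOuterMeasure (E (conj (prefixLits hl s))) := fun s => by
    have := hA _ ⟨prefixLits hl s, rfl⟩
    unfold Succeeds at this
    norm_num at this ⊢
    exact this
  have h0 : ENNReal.ofReal (3 / 4) ≤ (A.law D fun _ => false).toOuterMeasure
      (E fun _ => false) := by
    have := hA _ (false_mem_conjunctions hn)
    unfold Succeeds at this
    norm_num at this ⊢
    exact this
  -- Hypotheses good for `false` and for prefix `s` are disjoint events, as `1/4 + 1/4 < 1`. The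
  -- first has mass at least `3/4`, leaving at most `1/4`.
  have hup : ∀ s : Cube l, (A.law D fun _ => false).toOuterMeasure
      (E (conj (prefixLits hl s))) ≤ ENNReal.ofReal (1 / 4) := fun s => by
    set p := A.law D fun _ => false
    have hdis : Disjoint (E fun _ => false) (E (conj (prefixLits hl s))) := by
      rw [Set.disjoint_left]
      intro h h1 h2
      have := (one_le_robustRisk_add hl s D hr h).trans (add_le_add h1 h2)
      rw [← ENNReal.ofReal_add (by norm_num) (by norm_num), ENNReal.one_le_ofReal] at this
      norm_num at this
    have hun : p.toOuterMeasure (E fun _ => false) +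
        p.toOuterMeasure (E (conj (prefixLits hl s))) ≤ 1 := by
      simp only [PMF.toOuterMeasure_apply]
      rw [← ENNReal.tsum_add, ← p.tsum_coe]
      refine ENNReal.tsum_le_tsum fun h => ?_
      have : ¬ (h ∈ (E fun _ => false) ∧ h ∈ E (conj (prefixLits hl s))) :=
        fun hh => Set.disjoint_left.1 hdis hh.1 hh.2
      by_cases h1 : h ∈ (E fun _ => false) <;> by_cases h2 : h ∈ E (conj (prefixLits hl s)) <;>
        simp_all
    have h3 := (add_le_add_left h0 _).trans hun
    have h4 : (1 : ENNReal) = ENNReal.ofReal (3 / 4) + ENNReal.ofReal (1 / 4) := by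
      rw [← ENNReal.ofReal_add (by norm_num) (by norm_num)]; norm_num
    rw [h4] at h3
    exact (ENNReal.add_le_add_iff_left ENNReal.ofReal_ne_top).1 h3
  have h5 := (Finset.sum_le_sum fun s (_ : s ∈ Finset.univ) => hlow s).trans
    (hsum.trans (add_le_add_left (Finset.sum_le_sum fun s _ => hup s) _))
  simp only [Finset.sum_const, Finset.card_univ, Fintype.card_fun, Fintype.card_bool,
    Fintype.card_fin, nsmul_eq_mul] at h5
  rw [← ENNReal.ofReal_natCast, ← ENNReal.ofReal_natCast, ← ENNReal.ofReal_mul (by positivity),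
    ← ENNReal.ofReal_mul (by positivity), ← ENNReal.ofReal_add (by positivity) (by positivity),
    ENNReal.ofReal_le_ofReal_iff (by positivity)] at h5
  push_cast at h5
  have : (2 : ℝ) ^ l ≤ 2 * (m + q) := by linarith
  exact_mod_cast this

/-! ### Lower bound: asymptotics. -/

/-- The factor `4` is `2 (m + q)` at `m = q = n^k`; the minimum with `n` is there because a prefix
has at most `n` bits. -/
theorem eventually_lt_two_pow {ρ : ℕ → ℝ} (hρ : (fun n : ℕ => Real.log n) =o[atTop] ρ)
    (h0 : ∀ n, 0 ≤ ρ n) (k : ℕ) :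
    ∀ᶠ n : ℕ in atTop, 4 * n ^ k < 2 ^ min ⌊ρ n⌋₊ n := by
  -- The factor `2 (k + 4)` offsets `log 2 > 1/2`: it gives `l log 2 ≥ (k + 4) log n - 1/2`, and `4
  -- log n` covers the rounding loss and `log 4`.
  have h1 : ∀ᶠ n : ℕ in atTop, Real.log n ≤ (1 / (2 * (k + 4) : ℝ)) * ρ n := by
    filter_upwards [hρ.def (c := 1 / (2 * (k + 4) : ℝ)) (by positivity)] with n hn
    rw [Real.norm_of_nonneg (h0 n), Real.norm_of_nonneg (Real.log_natCast_nonneg n)] at hn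
    exact hn
  have h2 : ∀ᶠ n : ℕ in atTop, Real.log n ≤ (1 / (2 * (k + 4) : ℝ)) * n := by
    have := (Real.isLittleO_log_id_atTop.comp_tendsto tendsto_natCast_atTop_atTop).def
      (c := 1 / (2 * (k + 4) : ℝ)) (by positivity)
    filter_upwards [this] with n hn
    simp only [Function.comp, id] at hn
    rw [Real.norm_of_nonneg (Real.log_natCast_nonneg n), Real.norm_of_nonneg (by positivity)] at hn
    exact hn
  have h3 : ∀ᶠ n : ℕ in atTop, (4 : ℝ) ≤ Real.log n :=
    (Real.tendsto_log_atTop.comp tendsto_natCast_atTop_atTop).eventually_ge_atTop 4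
  filter_upwards [h1, h2, h3, eventually_gt_atTop 0] with n h1 h2 h3 hn
  have hk : (0 : ℝ) < 2 * (k + 4) := by positivity
  rw [div_mul_eq_mul_div, one_mul, le_div_iff₀ hk] at h1 h2
  set l := min ⌊ρ n⌋₊ n
  have hl : Real.log n * (2 * (k + 4)) - 1 ≤ l := by
    rcases le_total ⌊ρ n⌋₊ n with h | h
    · have : l = ⌊ρ n⌋₊ := min_eq_left h
      rw [this]
      linarith [Nat.lt_floor_add_one (ρ n)]
    · have : l = n := min_eq_right h
      rw [this]
      linarith
  have hlog2 : (1 / 2 : ℝ) < Real.log 2 := by linarith [Real.log_two_gt_d9]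
  have hlog2' : Real.log 2 < 1 := by linarith [Real.log_two_lt_d9]
  have hlog4 : Real.log 4 = 2 * Real.log 2 := by
    rw [show (4 : ℝ) = 2 ^ 2 by norm_num, Real.log_pow]; norm_num
  have hn' : (0 : ℝ) < n := by exact_mod_cast hn
  have key : Real.log (4 * (n : ℝ) ^ k) < Real.log ((2 : ℝ) ^ l) := by
    rw [Real.log_mul (by norm_num) (by positivity), Real.log_pow, Real.log_pow, hlog4]
    have : (l : ℝ) * (1 / 2) ≤ l * Real.log 2 := by gcongr
    nlinarith
  have := (Real.log_lt_log_iff (by positivity) (by positivity)).1 key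
  exact_mod_cast this

theorem eventually_not_learner {ρ : ℕ → ℝ} (h0 : ∀ n, 0 ≤ ρ n)
    (hρ : (fun n : ℕ => Real.log n) =o[atTop] ρ) (k : ℕ) :
    ∀ᶠ n : ℕ in atTop, ∀ A : Learner n,
      (∀ c ∈ Conjunctions n, Succeeds (uniform n) (ρ n) (1 / 4) (1 / 4) c A) →
      ∃ c ∈ Conjunctions n, ¬ (A.ExamplesAtMost c (n ^ k) ∧ A.QueriesAtMost c (n ^ k)) := by
  filter_upwards [eventually_lt_two_pow hρ h0 k, eventually_gt_atTop 0] with n hlt hn A hA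
  refine ⟨_, false_mem_conjunctions hn, fun ⟨hm, hq⟩ => ?_⟩
  have hr : ((min ⌊ρ n⌋₊ n : ℕ) : ℝ) ≤ ρ n :=
    le_trans (by exact_mod_cast min_le_left _ _) (Nat.floor_le (h0 n))
  have := two_pow_le_of_succeeds (min_le_right _ _) hn hr A hA _ _ hm hq
  omega

/-- With `ε` and `δ` fixed, `n` eventually exceeds the coefficients and both ceilings. -/
theorem eventually_polyBound_le (p : MvPolynomial (Fin 3) ℕ) (ε δ : ℝ) :
    ∃ k, ∀ᶠ n : ℕ in atTop, polyBound p n ε δ ≤ n ^ k := by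
  unfold polyBound
  induction p using MvPolynomial.induction_on with
  | C a =>
    refine ⟨1, ?_⟩
    filter_upwards [eventually_ge_atTop a] with n hn
    simpa using hn
  | add p q hp hq =>
    obtain ⟨k, hk⟩ := hp
    obtain ⟨k', hk'⟩ := hq
    refine ⟨max k k' + 1, ?_⟩
    filter_upwards [hk, hk', eventually_ge_atTop 2] with n h h' hn
    rw [map_add]
    have h1 := Nat.pow_le_pow_right (show 0 < n by omega) (le_max_left k k')
    have h2 := Nat.pow_le_pow_right (show 0 < n by omega) (le_max_right k k')
    rw [pow_succ]
    nlinarith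
  | mul_X p i hp =>
    obtain ⟨k, hk⟩ := hp
    refine ⟨k + 1, ?_⟩
    filter_upwards [hk, eventually_ge_atTop ⌈1 / ε⌉₊, eventually_ge_atTop ⌈1 / δ⌉₊]
      with n h h1 h2
    rw [map_mul, MvPolynomial.eval_X, pow_succ]
    refine Nat.mul_le_mul h ?_
    fin_cases i
    · exact le_rfl
    · exact h1
    · exact h2

theorem not_sampleEfficientlyLearnable (lam : ℕ → ℝ) {ρ : ℕ → ℝ} (h0 : ∀ n, 0 ≤ ρ n)
    (hρ : (fun n : ℕ => Real.log n) =o[atTop] ρ) :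
    ¬ SampleEfficientlyLearnable uniform Conjunctions lam ρ := by
  rintro ⟨A, p, h⟩
  obtain ⟨k, hk⟩ := eventually_polyBound_le p (1 / 4) (1 / 4)
  obtain ⟨n, h1, h2⟩ := (hk.and (eventually_not_learner h0 hρ k)).exists
  have hA := h n (1 / 4) (1 / 4) (by norm_num) (by norm_num)
  obtain ⟨c, hc, hcon⟩ := h2 (A n (1 / 4) (1 / 4)) fun c hc => (hA c hc).2.2.2
  exact hcon ⟨(hA c hc).1.mono h1, (hA c hc).2.1.mono h1⟩

end RobustLearning

theorem mainTheorem12 :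
    (∀ lam ρ : ℕ → ℝ, (∀ n, 0 ≤ ρ n) → ρ =Θ[atTop] (fun n : ℕ => Real.log n) →
      IsRobustnessThreshold uniform Conjunctions lam ρ ∧
      PolyTimeLearnable uniform Conjunctions lam ρ) ∧
    (∃ ε : ℝ, 0 < ε ∧ ∃ δ : ℝ, 0 < δ ∧
      ∀ ρ : ℕ → ℝ, (∀ n, 0 ≤ ρ n) → (fun n : ℕ => Real.log n) =o[atTop] ρ →
        ∀ k : ℕ, ∀ᶠ n : ℕ in atTop, ∀ A : Learner n,
          (∀ c ∈ Conjunctions n, Succeeds (uniform n) (ρ n) ε δ c A) →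
          ∃ c ∈ Conjunctions n,
            ¬ (A.ExamplesAtMost c (n ^ k) ∧ A.QueriesAtMost c (n ^ k))) := by
  refine ⟨fun lam ρ _ hρ => ⟨⟨sampleEfficientlyLearnable_conjunctions lam hρ.1,
    fun ρ' h0 hρ' => not_sampleEfficientlyLearnable lam h0 (hρ.2.trans_isLittleO hρ')⟩,
    polyTimeLearnable_conjunctions lam hρ.1⟩, 1 / 4, by norm_num, 1 / 4, by norm_num,
    fun ρ h0 hρ k => eventually_not_learner h0 hρ k⟩
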